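/- For a set $\mathcal F$ of forms (homogeneous polynomials, possibly of different degrees) in $\mathbb C[x_0,\dots,x_n]$, let $\operatorname{rk}_{\mathbb C}\mathcal F$ (the complex simultaneous Waring rank) be the least integer $r$ for which there are linear forms $L_1,\dots,L_r$ such that every $F\in\mathcal F$ can be written as $F=\sum_{j=1}^r\lambda_jL_j^{\deg F}$ with coefficients $\lambda_j\in\mathbb C$ depending on $F$; put $\operatorname{rk}_{\mathbb C}F=\operatorname{rk}_{\mathbb C}\{F\}$. **Proposition.** Let $n\ge 0$ and $c\ge 1$ be integers, and let $M_1=x_0^{c}x_1^{a_1}\cdots x_n^{a_n}$ and $M_2=x_0^{c}x_1^{b_1}\cdots x_n^{b_n}$ with $a_i\ge c$ and $b_i\ge c$ for $i=1,\dots,n$. Suppose that for every $i=1,\dots,n$ either $|a_i-b_i|\in\{0,1\}$ or $|a_i-b_i|\ge c+1$. Let $M_{12}=\gcd(M_1,M_2)$ be a greatest common divisor of $M_1$ and $M_2$ in $\mathbb C[x_0,\dots,x_n]$. Then the ranks below are all finite and $$\operatorname{rk}_{\mathbb C}\{M_1,M_2\}\le \operatorname{rk}_{\mathbb C}M_1+\operatorname{rk}_{\mathbb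 C}M_2-\operatorname{rk}_{\mathbb C}M_{12}.$$ -/

import Mathlib

open MvPolynomial

/-- The forms in `ℱ` (of possibly different degrees) have a common decomposition with `r` linear
forms: there are linear forms `L₁, …, L_r` such that every `F ∈ ℱ` is a linear combination of
`L₁ ^ d, …, L_r ^ d`, where `d = deg F`. -/
def HasSimultaneousWaringDecomposition {σ : Type*} (ℱ : Set (MvPolynomial σ ℂ)) (r : ℕ) : Prop :=
  ∃ L : Fin r → MvPolynomial σ ℂ, (∀ j, (L j).IsHomogeneous 1) ∧
    ∀ F ∈ ℱ, ∃ lam : Fin r → ℂ, F = ∑ j, C (lam j) * L j ^ F.totalDegree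

/-- The complex simultaneous Waring rank of a collection of forms: the minimal number of linear
forms in a common decomposition (`⊤` if there is no such decomposition). -/
noncomputable def simultaneousWaringRank {σ : Type*} (ℱ : Set (MvPolynomial σ ℂ)) : ℕ∞ :=
  ⨅ (r : ℕ) (_ : HasSimultaneousWaringDecomposition ℱ r), (r : ℕ∞)

/-- The complex Waring rank of a single form. -/
noncomputable def waringRank {σ : Type*} (F : MvPolynomial σ ℂ) : ℕ∞ :=
  simultaneousWaringRank {F}

/-- The monomial `x₀ ^ c * x₁ ^ a₁ * ⋯ * xₙ ^ aₙ` in `ℂ[x₀, …, xₙ]`. -/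
noncomputable def powerMonomial {n : ℕ} (c : ℕ) (a : Fin n → ℕ) : MvPolynomial (Fin (n + 1)) ℂ :=
  X 0 ^ c * ∏ i : Fin n, X i.succ ^ a i

/-- `D` is a greatest common divisor of `A` and `B` (it is unique up to units). -/
def IsGreatestCommonDivisor {R : Type*} [CommRing R] (D A B : R) : Prop :=
  D ∣ A ∧ D ∣ B ∧ ∀ E : R, E ∣ A → E ∣ B → E ∣ D

/-!
Call a set of `a + 1` numbers sparse if its nodal polynomial is `t ^ (a + 1) - q` with
`deg q ≤ a - c`. Lagrange interpolation equips such a set with weights whose `k`-th moment is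
`δ_{k,a}` for all `k ≤ a + c`. On a grid of sparse sets the product weights single out
`x₀ ^ c * x ^ a` among all monomials of its degree, so this monomial is a combination of powers of
the linear forms `x₀ + p₁ x₁ + ⋯ + pₙ xₙ` with `p` in the grid, and its rank is at most
`∏ (aᵢ + 1)`.

This is the exact rank when `1 ≤ c ≤ aᵢ`: evaluating the `∏ (aᵢ + 1)` affine monomials dividing
`x ^ a` at the dehomogenized points of any decomposition gives linearly independent vectors, since
the coefficients of the decomposition pair them triangularly with respect to the total degree.

The hypothesis on `aᵢ - bᵢ` allows the sparse sets for `aᵢ` and `bᵢ` to be chosen nested. The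
intersection of the two grids is then a grid for the greatest common divisor, and the theorem is
inclusion–exclusion for the union of the two grids.
-/

section WaringRank

variable {σ : Type*} {ℱ : Set (MvPolynomial σ ℂ)}

theorem HasSimultaneousWaringDecomposition.simultaneousWaringRank_le {r : ℕ}
    (h : HasSimultaneousWaringDecomposition ℱ r) : simultaneousWaringRank ℱ ≤ r :=
  iInf₂_le r h

theorem HasSimultaneousWaringDecomposition.of_mem_span {ι : Type*} (P : Finset ι)
    {L : ι → MvPolynomial σ ℂ} (hL : ∀ p ∈ P, (L p).IsHomogeneous 1)
    (h : ∀ F ∈ ℱ, F ∈ Submodule.span ℂ ((fun p => L p ^ F.totalDegree) '' P)) :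
    HasSimultaneousWaringDecomposition ℱ P.card := by
  refine ⟨fun j => L (P.equivFin.symm j), fun j => hL _ (P.equivFin.symm j).2, fun F hF => ?_⟩
  obtain ⟨lam, hlam⟩ := (Submodule.mem_span_image_finset_iff_exists_fun' ℂ).1 (h F hF)
  refine ⟨fun j => lam (P.equivFin.symm j), ?_⟩
  rw [Equiv.sum_comp P.equivFin.symm (fun p : P => C (lam p) * L p ^ F.totalDegree),
    Finset.sum_coe_sort P (fun p => C (lam p) * L p ^ F.totalDegree)]
  simpa only [smul_eq_C_mul] using hlam.symm

theorem totalDegree_C_mul_of_isUnit {R : Type*} [CommSemiring R] {u : R} (hu : IsUnit u)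
    (F : MvPolynomial σ R) : (C u * F).totalDegree = F.totalDegree := by
  obtain ⟨u, rfl⟩ := hu
  simp only [← smul_eq_C_mul]
  refine le_antisymm (totalDegree_smul_le _ _) ?_
  simpa only [smul_smul, Units.inv_mul, one_smul] using
    totalDegree_smul_le (↑u⁻¹ : R) ((u : R) • F)

theorem HasSimultaneousWaringDecomposition.C_mul {F : MvPolynomial σ ℂ} {r : ℕ} {u : ℂ}
    (hu : IsUnit u) (h : HasSimultaneousWaringDecomposition {F} r) :
    HasSimultaneousWaringDecomposition {C u * F} r := by
  obtain ⟨L, hL, h⟩ := h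
  obtain ⟨lam, hlam⟩ := h F rfl
  refine ⟨L, hL, ?_⟩
  rintro _ rfl
  refine ⟨fun j => u * lam j, ?_⟩
  rw [totalDegree_C_mul_of_isUnit hu]
  conv_lhs => rw [hlam, Finset.mul_sum]
  simp only [MvPolynomial.C_mul, mul_assoc]

theorem waringRank_C_mul {u : ℂ} (hu : IsUnit u) (F : MvPolynomial σ ℂ) :
    waringRank (C u * F) = waringRank F := by
  have hiff (r : ℕ) : HasSimultaneousWaringDecomposition {C u * F} r ↔
      HasSimultaneousWaringDecomposition {F} r := by
    refine ⟨fun h => ?_, fun h => h.C_mul hu⟩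
    have h' := h.C_mul hu.inv
    rwa [← mul_assoc, ← MvPolynomial.C_mul, inv_mul_cancel₀ hu.ne_zero, C_1, one_mul] at h'
  simp only [waringRank, simultaneousWaringRank, hiff]

end WaringRank

theorem exists_eq_sum_smul_X_of_isHomogeneous_one {σ R : Type*} [Fintype σ] [CommSemiring R]
    {L : MvPolynomial σ R} (hL : L.IsHomogeneous 1) : ∃ p : σ → R, L = ∑ i, p i • X i := by
  rw [← mem_homogeneousSubmodule, homogeneousSubmodule_one_eq_span_X,
    Submodule.mem_span_range_iff_exists_fun] at hL
  exact hL.imp fun _ hp => hp.symm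

theorem isHomogeneous_sum_smul_X {σ R : Type*} [Fintype σ] [CommSemiring R] (p : σ → R) :
    (∑ i, p i • X i : MvPolynomial σ R).IsHomogeneous 1 :=
  IsHomogeneous.sum _ _ _ fun i _ => by
    rw [smul_eq_C_mul]
    exact (isHomogeneous_X R i).C_mul (p i)

theorem coeff_sum_C_mul_pow_sum_smul_X {σ R ι : Type*} [Fintype σ] [CommSemiring R]
    (P : Finset ι) (p : ι → σ → R) (lam : ι → R) (d : ℕ) (m : σ →₀ ℕ) :
    coeff m (∑ j ∈ P, C (lam j) * (∑ i, p j i • X i) ^ d) =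
      if m.degree = d then (m.multinomial : R) * ∑ j ∈ P, lam j * ∏ i, p j i ^ m i else 0 := by
  have hm : (m.sum fun _ k => k) = m.degree := rfl
  simp only [coeff_sum, coeff_C_mul, coeff_linearCombination_X_pow_of_fintype, hm,
    Finsupp.prod_fintype _ _ (fun _ => pow_zero _)]
  split_ifs
  · rw [Finset.mul_sum]
    exact Finset.sum_congr rfl fun j _ => by ring
  · simp only [mul_zero, Finset.sum_const_zero]

theorem monomial_eq_sum_C_mul_pow_iff {σ R ι : Type*} [Fintype σ] [DecidableEq σ]
    [CommSemiring R] (P : Finset ι) (p : ι → σ → R) (lam : ι → R) (s : σ →₀ ℕ) :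
    monomial s 1 = ∑ j ∈ P, C (lam j) * (∑ i, p j i • X i) ^ s.degree ↔
      ∀ m : σ →₀ ℕ, m.degree = s.degree →
        (m.multinomial : R) * ∑ j ∈ P, lam j * ∏ i, p j i ^ m i = if m = s then 1 else 0 := by
  simp only [MvPolynomial.ext_iff, coeff_sum_C_mul_pow_sum_smul_X, coeff_monomial]
  refine forall_congr' fun m => ?_
  by_cases hdeg : m.degree = s.degree
  · simp only [hdeg, if_true, forall_const, eq_comm]
  · have hne : m ≠ s := fun h => hdeg (h ▸ rfl)
    simp only [hdeg, hne.symm, if_false, false_imp_iff]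

section PowerExponent

variable {n : ℕ}

/-- The exponent vector `(c, a₁, …, aₙ)` of `powerMonomial c a`. -/
noncomputable def powerExponent (c : ℕ) (a : Fin n → ℕ) : Fin (n + 1) →₀ ℕ :=
  Finsupp.cons c (Finsupp.equivFunOnFinite.symm a)

@[simp] theorem powerExponent_zero (c : ℕ) (a : Fin n → ℕ) : powerExponent c a 0 = c := rfl

@[simp] theorem powerExponent_succ (c : ℕ) (a : Fin n → ℕ) (i : Fin n) :
    powerExponent c a i.succ = a i := rfl

theorem eq_powerExponent_iff {m : Fin (n + 1) →₀ ℕ} {c : ℕ} {a : Fin n → ℕ} :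
    m = powerExponent c a ↔ m 0 = c ∧ ∀ i, m (Fin.succ i) = a i := by
  simp only [Finsupp.ext_iff, Fin.forall_fin_succ, powerExponent_zero, powerExponent_succ]

theorem powerExponent_inf_powerExponent (c : ℕ) (a b : Fin n → ℕ) :
    powerExponent c a ⊓ powerExponent c b = powerExponent c (a ⊓ b) := by
  simp [eq_powerExponent_iff]

theorem degree_powerExponent (c : ℕ) (a : Fin n → ℕ) :
    (powerExponent c a).degree = c + ∑ i, a i := by
  simp only [Finsupp.degree_eq_sum, Fin.sum_univ_succ, powerExponent_zero, powerExponent_succ]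

theorem powerMonomial_eq_monomial (c : ℕ) (a : Fin n → ℕ) :
    powerMonomial c a = monomial (powerExponent c a) 1 := by
  rw [monomial_eq, Finsupp.prod_fintype _ _ (fun _ => pow_zero _), Fin.prod_univ_succ]
  simp [powerMonomial]

theorem totalDegree_powerMonomial (c : ℕ) (a : Fin n → ℕ) :
    (powerMonomial c a).totalDegree = (powerExponent c a).degree := by
  rw [powerMonomial_eq_monomial, totalDegree_monomial _ one_ne_zero]
  rfl

end PowerExponent

section GreatestCommonDivisor

theorem IsGreatestCommonDivisor.exists_eq_monomial_inf {σ R : Type*} [CommRing R] [IsDomain R]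
    {D : MvPolynomial σ R} {s t : σ →₀ ℕ}
    (hD : IsGreatestCommonDivisor D (monomial s 1) (monomial t 1)) :
    ∃ u : R, IsUnit u ∧ D = monomial (s ⊓ t) u := by
  obtain ⟨hs, ht, hmax⟩ := hD
  obtain ⟨m, u, hms, hu, rfl⟩ := dvd_monomial_one_iff_exists.1 hs
  have hmt : m ≤ t := (monomial_dvd_monomial.1 ht).1.resolve_left one_ne_zero
  have hinf : monomial (s ⊓ t) (1 : R) ∣ monomial m u :=
    hmax _ (monomial_dvd_monomial.2 ⟨.inr inf_le_left, dvd_rfl⟩)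
      (monomial_dvd_monomial.2 ⟨.inr inf_le_right, dvd_rfl⟩)
  have hle : s ⊓ t ≤ m := (monomial_dvd_monomial.1 hinf).1.resolve_left hu.ne_zero
  exact ⟨u, hu, by rw [le_antisymm (le_inf hms hmt) hle]⟩

theorem IsGreatestCommonDivisor.exists_eq_C_mul_powerMonomial {n c : ℕ} {a b : Fin n → ℕ}
    {D : MvPolynomial (Fin (n + 1)) ℂ}
    (hD : IsGreatestCommonDivisor D (powerMonomial c a) (powerMonomial c b)) :
    ∃ u : ℂ, IsUnit u ∧ D = C u * powerMonomial c (a ⊓ b) := by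
  simp only [powerMonomial_eq_monomial] at hD
  obtain ⟨u, hu, rfl⟩ := hD.exists_eq_monomial_inf
  refine ⟨u, hu, ?_⟩
  rw [powerMonomial_eq_monomial, C_mul_monomial, mul_one, powerExponent_inf_powerExponent]

end GreatestCommonDivisor

section SparseNodeSet

/-- `S` consists of `a + 1` points and its nodal polynomial has the form `t ^ (a + 1) - q` with
`deg q ≤ a - c`. Products of such sets are the point sets used to decompose `powerMonomial c a`.
The degree bound is written additively, so that it forces `c ≤ a`. -/
structure IsSparseNodeSet {R : Type*} [CommSemiring R] (c a : ℕ) (S : Finset R) : Prop where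
  card_eq : S.card = a + 1
  exists_pow_eq_eval : ∃ q : Polynomial R, q.natDegree + c ≤ a ∧ ∀ s ∈ S, s ^ (a + 1) = q.eval s

variable {K : Type*} [Field K]

theorem sum_nodalWeight_mul_eval_eq_coeff {ι : Type*} [DecidableEq ι] {S : Finset ι} {v : ι → K}
    (hv : Set.InjOn v S) {a : ℕ} (hS : S.card = a + 1) {f : Polynomial K} (hf : f.natDegree ≤ a) :
    ∑ i ∈ S, Lagrange.nodalWeight S v i * f.eval (v i) = f.coeff a := by
  have hdeg : f.degree < S.card :=
    Polynomial.degree_le_natDegree.trans_lt (by rw [hS]; exact_mod_cast Nat.lt_succ_of_le hf)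
  have hcoeff := Lagrange.coeff_eq_sum hv hdeg
  rw [hS, Nat.add_sub_cancel] at hcoeff
  rw [hcoeff]
  refine Finset.sum_congr rfl fun i _ => ?_
  rw [Lagrange.nodalWeight, Finset.prod_inv_distrib, div_eq_inv_mul]

theorem IsSparseNodeSet.sum_nodalWeight_mul_pow [DecidableEq K] {c a k : ℕ} {S : Finset K}
    (hS : IsSparseNodeSet c a S) (hk : k ≤ a + c) :
    ∑ s ∈ S, Lagrange.nodalWeight S id s * s ^ k = if k = a then 1 else 0 := by
  obtain ⟨hcard, q, hq, hroot⟩ := hS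
  have hlagrange {f : Polynomial K} (hf : f.natDegree ≤ a) :
      ∑ s ∈ S, Lagrange.nodalWeight S id s * f.eval s = f.coeff a :=
    sum_nodalWeight_mul_eval_eq_coeff Function.injective_id.injOn hcard hf
  rcases Nat.lt_or_ge a k with hak | hka
  · obtain ⟨d, rfl⟩ := Nat.exists_eq_add_of_le hak
    -- On `S` the power `t ^ (a + 1 + d)` agrees with `q * t ^ d`, whose degree is less than `a`.
    have hdeg : (q * Polynomial.X ^ d).natDegree < a := by
      have hmul := Polynomial.natDegree_mul_le (p := q) (q := Polynomial.X ^ d)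
      rw [Polynomial.natDegree_X_pow] at hmul
      omega
    rw [if_neg (by omega), ← Polynomial.coeff_eq_zero_of_natDegree_lt hdeg,
      ← hlagrange hdeg.le]
    refine Finset.sum_congr rfl fun s hs => ?_
    rw [pow_add, hroot s hs, Polynomial.eval_mul, Polynomial.eval_pow, Polynomial.eval_X]
  · have hsum := hlagrange (f := Polynomial.X ^ k) (by simpa using hka)
    simpa [Polynomial.coeff_X_pow, eq_comm] using hsum

theorem IsSparseNodeSet.card_piFinset {R ι : Type*} [CommSemiring R] [Fintype ι] [DecidableEq ι]
    {c : ℕ} {a : ι → ℕ} {S : ι → Finset R} (hS : ∀ i, IsSparseNodeSet c (a i) (S i)) :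
    (Fintype.piFinset S).card = ∏ i, (a i + 1) := by
  simp only [Fintype.card_piFinset, (hS _).card_eq]

end SparseNodeSet

section NestedNodeSets

open Polynomial (nthRootsFinset mem_nthRootsFinset)

variable {K : Type*} [Field K] [IsAlgClosed K] [CharZero K] {c a b : ℕ}

theorem card_nthRootsFinset_of_ne_zero {k : ℕ} (hk : k ≠ 0) {z : K} (hz : z ≠ 0) :
    (nthRootsFinset k z).card = k := by
  classical
  have hnodup : (Polynomial.nthRoots k z).Nodup :=
    Polynomial.nodup_roots (Polynomial.separable_X_pow_sub_C z (Nat.cast_ne_zero.2 hk) hz)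
  rw [Polynomial.nthRootsFinset_def, Multiset.toFinset_card_of_nodup hnodup, Polynomial.nthRoots,
    IsAlgClosed.card_roots_eq_natDegree, Polynomial.natDegree_X_pow_sub_C]

theorem isSparseNodeSet_nthRootsFinset (hca : c ≤ a) {z : K} (hz : z ≠ 0) :
    IsSparseNodeSet c a (nthRootsFinset (a + 1) z) where
  card_eq := card_nthRootsFinset_of_ne_zero a.succ_ne_zero hz
  exists_pow_eq_eval := ⟨Polynomial.C z, by simpa using hca, fun s hs => by
    rw [Polynomial.eval_C, (mem_nthRootsFinset a.succ_pos z).1 hs]⟩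

theorem isSparseNodeSet_insert_zero_nthRootsFinset [DecidableEq K] (hca : c ≤ a) {z : K}
    (hz : z ≠ 0) : IsSparseNodeSet c (a + 1) (insert 0 (nthRootsFinset (a + 1) z)) where
  card_eq := by
    rw [Finset.card_insert_of_notMem, card_nthRootsFinset_of_ne_zero a.succ_ne_zero hz]
    exact fun h => Polynomial.ne_zero_of_mem_nthRootsFinset hz h rfl
  exists_pow_eq_eval := by
    refine ⟨Polynomial.C z * Polynomial.X, ?_, fun s hs => ?_⟩
    · rw [Polynomial.natDegree_C_mul_X z hz]
      omega
    · rw [Polynomial.eval_mul, Polynomial.eval_C, Polynomial.eval_X, pow_succ]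
      rcases Finset.mem_insert.1 hs with rfl | hs
      · rw [mul_zero, mul_zero]
      · rw [(mem_nthRootsFinset a.succ_pos z).1 hs]

theorem isSparseNodeSet_nthRootsFinset_union [DecidableEq K] (hca : c ≤ a) (hcb : c ≤ b) {y z : K}
    (hy : y ≠ 0) (hz : z ≠ 0)
    (hdisj : Disjoint (nthRootsFinset (a + 1) y) (nthRootsFinset (b + 1) z)) :
    IsSparseNodeSet c (a + b + 1) (nthRootsFinset (a + 1) y ∪ nthRootsFinset (b + 1) z) where
  card_eq := by
    rw [Finset.card_union_of_disjoint hdisj, card_nthRootsFinset_of_ne_zero a.succ_ne_zero hy,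
      card_nthRootsFinset_of_ne_zero b.succ_ne_zero hz]
    omega
  exists_pow_eq_eval := by
    -- `q` is read off from `(t ^ (a + 1) - y) * (t ^ (b + 1) - z) = t ^ (a + b + 2) - q`.
    let q : Polynomial K := Polynomial.C y * Polynomial.X ^ (b + 1) +
      Polynomial.C z * Polynomial.X ^ (a + 1) - Polynomial.C (y * z)
    refine ⟨q, ?_, fun s hs => ?_⟩
    · have hdeg : q.natDegree ≤ max (b + 1) (a + 1) := by
        simp only [q]
        compute_degree!
      omega
    · have hpow : s ^ (a + b + 1 + 1) = s ^ (a + 1) * s ^ (b + 1) := by ring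
      simp only [q, hpow, Polynomial.eval_sub, Polynomial.eval_add, Polynomial.eval_mul,
        Polynomial.eval_pow, Polynomial.eval_X, Polynomial.eval_C]
      rcases Finset.mem_union.1 hs with hs | hs
      · rw [(mem_nthRootsFinset a.succ_pos y).1 hs]
        ring
      · rw [(mem_nthRootsFinset b.succ_pos z).1 hs]
        ring

theorem disjoint_nthRootsFinset_one_two {R : Type*} [CommRing R] [IsDomain R] [CharZero R]
    {k l : ℕ} (hk : k ≠ 0) (hl : l ≠ 0) :
    Disjoint (nthRootsFinset k (1 : R)) (nthRootsFinset l 2) := by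
  refine Finset.disjoint_left.2 fun s hs₁ hs₂ => ?_
  rw [mem_nthRootsFinset (Nat.pos_of_ne_zero hk)] at hs₁
  rw [mem_nthRootsFinset (Nat.pos_of_ne_zero hl)] at hs₂
  have htwo : (2 : R) ^ k = 1 := by rw [← hs₂, ← pow_mul, mul_comm, pow_mul, hs₁, one_pow]
  exact (Nat.one_lt_two_pow hk).ne' (by exact_mod_cast htwo)

theorem exists_subset_isSparseNodeSet (K : Type*) [Field K] [IsAlgClosed K] [CharZero K]
    (hca : c ≤ a) (hab : b = a ∨ b = a + 1 ∨ a + c + 1 ≤ b) :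
    ∃ S T : Finset K, S ⊆ T ∧ IsSparseNodeSet c a S ∧ IsSparseNodeSet c b T := by
  classical
  have hS := isSparseNodeSet_nthRootsFinset hca (one_ne_zero (α := K))
  rcases hab with rfl | rfl | h
  · exact ⟨_, _, subset_rfl, hS, hS⟩
  · exact ⟨_, _, Finset.subset_insert _ _, hS,
      isSparseNodeSet_insert_zero_nthRootsFinset hca one_ne_zero⟩
  · obtain ⟨d, rfl⟩ := Nat.exists_eq_add_of_le h
    refine ⟨_, _ ∪ nthRootsFinset (c + d + 1) 2, Finset.subset_union_left, hS, ?_⟩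
    rw [show a + c + 1 + d = a + (c + d) + 1 by ring]
    exact isSparseNodeSet_nthRootsFinset_union hca (Nat.le_add_right c d) one_ne_zero two_ne_zero
      (disjoint_nthRootsFinset_one_two a.succ_ne_zero (c + d).succ_ne_zero)

theorem exists_isSparseNodeSet_inter (K : Type*) [Field K] [IsAlgClosed K] [CharZero K]
    [DecidableEq K] (hca : c ≤ a) (hcb : c ≤ b)
    (hab : |(a : ℤ) - b| = 0 ∨ |(a : ℤ) - b| = 1 ∨ (c : ℤ) + 1 ≤ |(a : ℤ) - b|) :
    ∃ S T : Finset K, IsSparseNodeSet c a S ∧ IsSparseNodeSet c b T ∧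
      IsSparseNodeSet c (a ⊓ b) (S ∩ T) := by
  rcases le_total a b with h | h
  · obtain ⟨S, T, hST, hS, hT⟩ := exists_subset_isSparseNodeSet K hca (b := b) (by grind)
    exact ⟨S, T, hS, hT, by rwa [inf_eq_left.2 h, Finset.inter_eq_left.2 hST]⟩
  · obtain ⟨T, S, hTS, hT, hS⟩ := exists_subset_isSparseNodeSet K hcb (b := a) (by grind)
    exact ⟨S, T, hS, hT, by rwa [inf_eq_right.2 h, Finset.inter_eq_right.2 hTS]⟩

end NestedNodeSets

section UpperBound

variable {n c : ℕ} {a : Fin n → ℕ}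

theorem le_add_of_degree_eq_degree_powerExponent {m : Fin (n + 1) →₀ ℕ}
    (hm : m.degree = (powerExponent c a).degree) (hle : ∀ i, a i ≤ m (Fin.succ i)) (i : Fin n) :
    m i.succ ≤ a i + c := by
  rw [Finsupp.degree_eq_sum, Fin.sum_univ_succ, degree_powerExponent] at hm
  have hrest := Finset.sum_le_sum fun j (_ : j ∈ Finset.univ.erase i) => hle j
  have hm_erase := Finset.add_sum_erase _ (fun j : Fin n => m j.succ) (Finset.mem_univ i)
  have ha_erase := Finset.add_sum_erase _ a (Finset.mem_univ i)
  omega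

theorem eq_powerExponent_of_degree_eq {m : Fin (n + 1) →₀ ℕ}
    (hm : m.degree = (powerExponent c a).degree) (heq : ∀ i, m (Fin.succ i) = a i) :
    m = powerExponent c a := by
  refine eq_powerExponent_iff.2 ⟨?_, heq⟩
  simpa only [Finsupp.degree_eq_sum, Fin.sum_univ_succ, degree_powerExponent, heq,
    powerExponent_zero, powerExponent_succ, add_left_inj] using hm

theorem prod_sum_mul_pow_eq_ite {R : Type*} [CommSemiring R] {S : Fin n → Finset R}
    {w : Fin n → R → R}
    (hw : ∀ i, ∀ k ≤ a i + c, ∑ s ∈ S i, w i s * s ^ k = if k = a i then 1 else 0)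
    {m : Fin (n + 1) →₀ ℕ} (hm : m.degree = (powerExponent c a).degree) :
    ∏ i, ∑ s ∈ S i, w i s * s ^ m i.succ = if m = powerExponent c a then 1 else 0 := by
  split_ifs with h
  · subst h
    exact Finset.prod_eq_one fun i _ => by simp [hw]
  obtain ⟨i, hle, hne⟩ : ∃ i : Fin n, m i.succ ≤ a i + c ∧ m i.succ ≠ a i := by
    by_cases hlow : ∀ i, a i ≤ m (Fin.succ i)
    · by_contra! heq
      exact h (eq_powerExponent_of_degree_eq hm fun i =>
        heq i (le_add_of_degree_eq_degree_powerExponent hm hlow i))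
    · obtain ⟨i, hi⟩ := not_forall.1 hlow
      exact ⟨i, by omega, by omega⟩
  exact Finset.prod_eq_zero (Finset.mem_univ i) (by rw [hw i _ hle, if_neg hne])

/-- The linear form `x₀ + p₁ x₁ + ⋯ + pₙ xₙ` attached to an affine point `p`. -/
noncomputable def pointForm {R : Type*} [CommSemiring R] (p : Fin n → R) :
    MvPolynomial (Fin (n + 1)) R :=
  ∑ i, (Fin.cons 1 p : Fin (n + 1) → R) i • X i

theorem monomial_powerExponent_eq_sum_piFinset {K : Type*} [Field K] [CharZero K]
    {S : Fin n → Finset K} {w : Fin n → K → K}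
    (hw : ∀ i, ∀ k ≤ a i + c, ∑ s ∈ S i, w i s * s ^ k = if k = a i then 1 else 0) :
    monomial (powerExponent c a) 1 = ∑ p ∈ Fintype.piFinset S,
      C (((powerExponent c a).multinomial : K)⁻¹ * ∏ i, w i (p i)) *
        pointForm p ^ (powerExponent c a).degree := by
  refine (monomial_eq_sum_C_mul_pow_iff _ (fun p => Fin.cons 1 p) _ _).2 fun m hm => ?_
  have hmoment : ∑ p ∈ Fintype.piFinset S, ((powerExponent c a).multinomial : K)⁻¹ *
      (∏ i, w i (p i)) * ∏ i, (Fin.cons 1 p : Fin (n + 1) → K) i ^ m i =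
      ((powerExponent c a).multinomial : K)⁻¹ * ∏ i, ∑ s ∈ S i, w i s * s ^ m i.succ := by
    rw [Finset.prod_univ_sum, Finset.mul_sum]
    refine Finset.sum_congr rfl fun p _ => ?_
    simp [Fin.prod_univ_succ, Finset.prod_mul_distrib, mul_assoc]
  rw [hmoment, prod_sum_mul_pow_eq_ite hw hm]
  split_ifs with h
  · rw [h, mul_one, mul_inv_cancel₀ (Nat.cast_ne_zero.2 (Nat.multinomial_pos _ _).ne')]
  · rw [mul_zero, mul_zero]

theorem powerMonomial_mem_span_pointForm {S : Fin n → Finset ℂ}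
    (hS : ∀ i, IsSparseNodeSet c (a i) (S i)) :
    powerMonomial c a ∈ Submodule.span ℂ
      ((fun p => pointForm p ^ (powerMonomial c a).totalDegree) '' Fintype.piFinset S) := by
  classical
  rw [totalDegree_powerMonomial, powerMonomial_eq_monomial,
    monomial_powerExponent_eq_sum_piFinset fun i k => (hS i).sum_nodalWeight_mul_pow]
  refine Submodule.sum_mem _ fun p hp => ?_
  rw [← smul_eq_C_mul]
  exact Submodule.smul_mem _ _ (Submodule.subset_span (Set.mem_image_of_mem _ hp))

theorem waringRank_powerMonomial_le (hca : ∀ i, c ≤ a i) :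
    waringRank (powerMonomial c a) ≤ (∏ i, (a i + 1) : ℕ) := by
  have hS (i) := isSparseNodeSet_nthRootsFinset (hca i) (one_ne_zero (α := ℂ))
  rw [← IsSparseNodeSet.card_piFinset hS]
  refine (HasSimultaneousWaringDecomposition.of_mem_span (L := pointForm) _
    (fun p _ => isHomogeneous_sum_smul_X _) ?_).simultaneousWaringRank_le
  rintro _ rfl
  exact powerMonomial_mem_span_pointForm hS

theorem simultaneousWaringRank_pair_powerMonomial_le {b : Fin n → ℕ} {S T : Fin n → Finset ℂ}
    (hS : ∀ i, IsSparseNodeSet c (a i) (S i)) (hT : ∀ i, IsSparseNodeSet c (b i) (T i)) :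
    simultaneousWaringRank {powerMonomial c a, powerMonomial c b} ≤
      (Fintype.piFinset S ∪ Fintype.piFinset T).card := by
  refine (HasSimultaneousWaringDecomposition.of_mem_span (L := pointForm) _
    (fun p _ => isHomogeneous_sum_smul_X _) ?_).simultaneousWaringRank_le
  rintro _ (rfl | rfl)
  · exact Submodule.span_mono (Set.image_mono (Finset.coe_subset.2 Finset.subset_union_left))
      (powerMonomial_mem_span_pointForm hS)
  · exact Submodule.span_mono (Set.image_mono (Finset.coe_subset.2 Finset.subset_union_right))
      (powerMonomial_mem_span_pointForm hT)

end UpperBound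

section LowerBound

theorem linearIndependent_of_triangular_dual {ι R M α : Type*} [Ring R] [NoZeroDivisors R]
    [AddCommGroup M] [Module R M] [LinearOrder α] (v : ι → M) (φ : ι → M →ₗ[R] R) (d : ι → α)
    (hdiag : ∀ i, φ i (v i) ≠ 0) (hoff : ∀ i j, d j ≤ d i → j ≠ i → φ i (v j) = 0) :
    LinearIndependent R v := by
  classical
  rw [linearIndependent_iff']
  intro s g hg
  by_contra! hne
  obtain ⟨i₀, hi₀, hgi₀⟩ := hne
  obtain ⟨i, hi, hmax⟩ := (s.filter fun i => g i ≠ 0).exists_max_image d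
    ⟨i₀, Finset.mem_filter.2 ⟨hi₀, hgi₀⟩⟩
  obtain ⟨his, hgi⟩ := Finset.mem_filter.1 hi
  have hzero : ∑ j ∈ s, g j * φ i (v j) = 0 := by
    simpa only [map_sum, map_smul, smul_eq_mul, map_zero] using congrArg (φ i) hg
  rw [Finset.sum_eq_single_of_mem i his] at hzero
  · exact mul_ne_zero hgi (hdiag i) hzero
  · intro j hj hji
    by_cases hgj : g j = 0
    · rw [hgj, zero_mul]
    · rw [hoff i j (hmax j (Finset.mem_filter.2 ⟨hj, hgj⟩)) hji, mul_zero]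

variable {n c : ℕ} {a : Fin n → ℕ} {K : Type*} [Field K]

/-- The value of the affine monomial `x ^ f` at the dehomogenization of `p` with respect to the
coordinate `p 0`. If `p 0 = 0` this is a junk value, which only ever occurs multiplied by a
positive power of `p 0`. -/
def affineMonomial (p : Fin (n + 1) → K) (f : Fin n → ℕ) : K :=
  ∏ i, (p i.succ / p 0) ^ f i

theorem pow_mul_affineMonomial (p : Fin (n + 1) → K) {k : ℕ} (b : Fin n → ℕ) {f : Fin n → ℕ}
    (hf : ∑ i, f i < k) :
    p 0 ^ k * (∏ i, p i.succ ^ b i) * affineMonomial p f =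
      ∏ i, p i ^ powerExponent (k - ∑ i, f i) (b + f) i := by
  simp only [Fin.prod_univ_succ, powerExponent_zero, powerExponent_succ, Pi.add_apply]
  by_cases h0 : p 0 = 0
  · rw [h0, zero_pow (by omega), zero_pow (by omega), zero_mul, zero_mul, zero_mul]
  have hpow : p 0 ^ k = p 0 ^ (k - ∑ i, f i) * ∏ i, p 0 ^ f i := by
    rw [Finset.prod_pow_eq_pow_sum, ← pow_add, Nat.sub_add_cancel hf.le]
  have hcancel : (∏ i, p 0 ^ f i) * affineMonomial p f = ∏ i, p i.succ ^ f i := by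
    rw [affineMonomial, ← Finset.prod_mul_distrib]
    exact Finset.prod_congr rfl fun i _ => by rw [← mul_pow, mul_div_cancel₀ _ h0]
  simp only [pow_add, Finset.prod_mul_distrib]
  rw [hpow, ← hcancel]
  ring

theorem degree_powerExponent_sub_add {e f : Fin n → ℕ} (he : e ≤ a) (hfe : ∑ i, f i ≤ ∑ i, e i) :
    (powerExponent (c + ∑ i, e i - ∑ i, f i) (a - e + f)).degree = (powerExponent c a).degree := by
  have hsum : ∑ i, (a i - e i) + ∑ i, e i = ∑ i, a i := by
    rw [← Finset.sum_add_distrib]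
    exact Finset.sum_congr rfl fun i _ => Nat.sub_add_cancel (he i)
  simp only [degree_powerExponent, Pi.add_apply, Pi.sub_apply, Finset.sum_add_distrib]
  omega

theorem powerExponent_sub_add_eq_iff {e f : Fin n → ℕ} (he : e ≤ a) :
    powerExponent (c + ∑ i, e i - ∑ i, f i) (a - e + f) = powerExponent c a ↔ f = e := by
  simp only [eq_powerExponent_iff, powerExponent_zero, powerExponent_succ, Pi.add_apply,
    Pi.sub_apply]
  constructor
  · rintro ⟨-, h⟩
    funext i
    have hea : e i ≤ a i := he i
    have hi := h i
    omega
  · rintro rfl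
    exact ⟨Nat.add_sub_cancel _ _, fun i => Nat.sub_add_cancel (he i)⟩

theorem linearIndependent_affineMonomial {ι : Type*} [Fintype ι] (hc : 1 ≤ c)
    {p : ι → Fin (n + 1) → K} {lam : ι → K}
    (hmoment : ∀ m : Fin (n + 1) →₀ ℕ, m.degree = (powerExponent c a).degree →
      (∑ j, lam j * ∏ i, p j i ^ m i = 0 ↔ m ≠ powerExponent c a)) :
    LinearIndependent K fun (e : ∀ i, Fin (a i + 1)) j => affineMonomial (p j) fun i => e i := by
  -- The functional attached to `e` pairs the vector of `f` to the moment of exponent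
  -- `(c + |e| - |f|, a - e + f)`, which for `|f| ≤ |e|` is nonzero exactly when `f = e`.
  let φ (e : Fin n → ℕ) : (ι → K) →ₗ[K] K := Fintype.linearCombination K fun j =>
    lam j * (p j 0 ^ (c + ∑ i, e i) * ∏ i, p j i.succ ^ (a - e) i)
  have hφ {e f : Fin n → ℕ} (he : e ≤ a) (hfe : ∑ i, f i ≤ ∑ i, e i) :
      φ e (fun j => affineMonomial (p j) f) = 0 ↔ f ≠ e := by
    rw [Ne, ← powerExponent_sub_add_eq_iff (c := c) he, ← Ne,
      ← hmoment _ (degree_powerExponent_sub_add he hfe)]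
    simp only [φ, Fintype.linearCombination_apply, smul_eq_mul,
      ← pow_mul_affineMonomial (k := c + ∑ i, e i) _ (a - e) (f := f) (by omega)]
    exact Eq.congr_left (Finset.sum_congr rfl fun j _ => by ring)
  have hle (e : ∀ i, Fin (a i + 1)) : (fun i => (e i : ℕ)) ≤ a := fun i => Fin.is_le (e i)
  refine linearIndependent_of_triangular_dual _ (fun e => φ fun i => e i)
    (fun e => ∑ i, (e i : ℕ)) (fun e h => (hφ (hle e) le_rfl).1 h rfl) fun e f hfe hne => ?_
  refine (hφ (hle e) hfe).2 fun h => hne ?_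
  exact funext fun i => Fin.ext (congrFun h i)

theorem prod_succ_le_of_hasSimultaneousWaringDecomposition {r : ℕ} (hc : 1 ≤ c)
    (h : HasSimultaneousWaringDecomposition {powerMonomial c a} r) : ∏ i, (a i + 1) ≤ r := by
  obtain ⟨L, hL, h⟩ := h
  obtain ⟨lam, hlam⟩ := h _ rfl
  choose p hp using fun j => exists_eq_sum_smul_X_of_isHomogeneous_one (hL j)
  rw [totalDegree_powerMonomial, powerMonomial_eq_monomial] at hlam
  simp only [hp] at hlam
  have hindep := linearIndependent_affineMonomial (a := a) hc (p := p) (lam := lam) fun m hm => by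
    have hcoeff := (monomial_eq_sum_C_mul_pow_iff _ p _ _).1 hlam m hm
    have hmult : (m.multinomial : ℂ) ≠ 0 := Nat.cast_ne_zero.2 (Nat.multinomial_pos _ _).ne'
    rw [← mul_eq_zero_iff_left hmult, hcoeff, ite_eq_right_iff]
    simp
  simpa using hindep.fintype_card_le_finrank

end LowerBound

theorem waringRank_powerMonomial {n c : ℕ} {a : Fin n → ℕ} (hc : 1 ≤ c) (hca : ∀ i, c ≤ a i) :
    waringRank (powerMonomial c a) = (∏ i, (a i + 1) : ℕ) :=
  le_antisymm (waringRank_powerMonomial_le hca) <| le_iInf₂ fun _ h =>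
    Nat.cast_le.2 (prod_succ_le_of_hasSimultaneousWaringDecomposition hc h)

theorem mainTheorem7 (n c : ℕ) (a b : Fin n → ℕ) (hc : 1 ≤ c)
    (ha : ∀ i, c ≤ a i) (hb : ∀ i, c ≤ b i)
    (hab : ∀ i, |(a i : ℤ) - b i| = 0 ∨ |(a i : ℤ) - b i| = 1 ∨ (c : ℤ) + 1 ≤ |(a i : ℤ) - b i|)
    (M₁₂ : MvPolynomial (Fin (n + 1)) ℂ)
    (hM₁₂ : IsGreatestCommonDivisor M₁₂ (powerMonomial c a) (powerMonomial c b)) :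
    ∃ r r₁ r₂ r₁₂ : ℕ,
      simultaneousWaringRank {powerMonomial c a, powerMonomial c b} = (r : ℕ∞) ∧
      waringRank (powerMonomial c a) = (r₁ : ℕ∞) ∧
      waringRank (powerMonomial c b) = (r₂ : ℕ∞) ∧
      waringRank M₁₂ = (r₁₂ : ℕ∞) ∧
      (r : ℤ) ≤ r₁ + r₂ - r₁₂ := by
  classical
  choose S T hS hT hST using fun i => exists_isSparseNodeSet_inter ℂ (ha i) (hb i) (hab i)
  obtain ⟨u, hu, rfl⟩ := hM₁₂.exists_eq_C_mul_powerMonomial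
  have hM : waringRank (C u * powerMonomial c (a ⊓ b)) = (∏ i, ((a ⊓ b) i + 1) : ℕ) :=
    (waringRank_C_mul hu _).trans (waringRank_powerMonomial hc fun i => le_inf (ha i) (hb i))
  have hcard : (Fintype.piFinset S ∪ Fintype.piFinset T).card + ∏ i, ((a ⊓ b) i + 1) =
      ∏ i, (a i + 1) + ∏ i, (b i + 1) := by
    rw [← IsSparseNodeSet.card_piFinset hS, ← IsSparseNodeSet.card_piFinset hT,
      ← IsSparseNodeSet.card_piFinset (a := a ⊓ b) hST, Fintype.piFinset_inter,
      Finset.card_union_add_card_inter]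
  obtain ⟨r, hr, hr_le⟩ :=
    ENat.le_natCast_iff.1 (simultaneousWaringRank_pair_powerMonomial_le hS hT)
  exact ⟨r, _, _, _, hr, waringRank_powerMonomial hc ha, waringRank_powerMonomial hc hb, hM,
    by omega⟩
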